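/- A graphing $\mathbf G=(J,\mathcal B,E,\lambda)$ consists of a standard Borel space $(J,\mathcal B)$, a Borel set $E$ of unordered pairs of distinct points of $J$ (equivalently, a symmetric Borel subset of $J\times J$ avoiding the diagonal) such that all degrees of the graph $(J,E)$ are at most some integer $D$, and a probability measure $\lambda$ on $\mathcal B$ such that $\int_A \deg_B\,d\lambda=\int_B\deg_A\,d\lambda$ for all $A,B\in\mathcal B$, where $\deg_B(x)$ is the number of edges from $x$ to $B$. Let $\overline d=\int_J\deg\,d\lambda$ be the average degree, and let $\eta$ be the edge measure, i.e. the measure on $J\times J$ with $\eta(A\times B)=\frac1{\overline d}\int_A\deg_B\,d\lambda$ for $A,B\in\mathcal B$ ($\eta=0$ if $\overline d=0$); for a Borel set $U\subseteq E$, $\eta(U)$ is the measure of the symmetric set $\{(x,y): xy\in U\}$. For a Borel set $U\subseteq E$ put $$\rho(U)=1-\int_J \frac1{|U_x|}\,d\lambda(x),$$ where $U_x$ is the vertex set of the connected component of the graph $(J,U)$ containing $x$, and $1/|U_x|=0$ if $U_x$ is infinite. The graphing is hyperfinite if for every $\varepsilon>0$ there is a Borel set $X\subseteq E$ with $\eta(X)<\varepsilon$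 such that all connected components of $(J,E\setminus X)$ are finite. **Lemma.** Let $\mathbf G=(J,\mathcal B,E,\lambda)$ be a hyperfinite graphing such that every connected component of $(J,E)$ is a tree. Then for every Borel set $U\subseteq E$, $$\rho(U)=\frac{\overline d}{2}\,\eta(U).$$ In particular, $\rho$ is a (finite, countably additive) measure on the Borel subsets of $E$. -/

import Mathlib

open MeasureTheory Set
open scoped ENNReal

noncomputable section

/-- A Borel set all of whose vertical sections have at most `D` points has a measurable section
counting function. -/
theorem measurable_encard_section {J : Type*} [MeasurableSpace J] [StandardBorelSpace J] (D : ℕ) :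
    ∀ R : Set (J × J), MeasurableSet R → (∀ x, {y | (x, y) ∈ R}.encard ≤ D) →
      Measurable fun x => {y | (x, y) ∈ R}.encard := by
  induction D with
  | zero =>
    intro R _ hD
    have h : (fun x => {y | (x, y) ∈ R}.encard) = fun _ => 0 := by
      funext x
      simpa using hD x
    rw [h]
    exact measurable_const
  | succ D ih =>
    intro R hR hD
    let e := embeddingReal J
    have he : Measurable e := measurable_embeddingReal J
    have hinj : Function.Injective e := (measurableEmbedding_embeddingReal J).injective
    let T : Set (J × (Fin (D + 1) → J)) :=
      {p | (∀ i, (p.1, p.2 i) ∈ R) ∧ ∀ i j, i < j → e (p.2 i) < e (p.2 j)}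
    have hT : MeasurableSet T := by
      have h1 : MeasurableSet {p : J × (Fin (D + 1) → J) | ∀ i, (p.1, p.2 i) ∈ R} := by
        rw [ofPred_forall]
        refine MeasurableSet.iInter fun i => ?_
        exact (measurable_fst.prodMk ((measurable_pi_apply i).comp measurable_snd)) hR
      have h2 : MeasurableSet
          {p : J × (Fin (D + 1) → J) | ∀ i j, i < j → e (p.2 i) < e (p.2 j)} := by
        simp only [ofPred_forall]
        refine MeasurableSet.iInter fun i => MeasurableSet.iInter fun j =>
          MeasurableSet.iInter fun _ => ?_
        exact measurableSet_lt (he.comp ((measurable_pi_apply i).comp measurable_snd))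
          (he.comp ((measurable_pi_apply j).comp measurable_snd))
      exact h1.inter h2
    have hrange : ∀ p ∈ T, range p.2 = {y | (p.1, y) ∈ R} := by
      intro p hp
      have hpi : Function.Injective p.2 := by
        have : StrictMono (e ∘ p.2) := fun i j hij => hp.2 i j hij
        exact this.injective.of_comp
      have hfin : {y | (p.1, y) ∈ R}.Finite := finite_of_encard_le_coe (hD p.1)
      refine (hfin.subset ?_).eq_of_subset_of_encard_le ?_ ?_
      · rintro _ ⟨i, rfl⟩
        exact hp.1 i
      · rintro _ ⟨i, rfl⟩
        exact hp.1 i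
      · refine (hD p.1).trans (le_of_eq ?_)
        rw [← image_univ, hpi.encard_image, encard_univ]
        simp
    have hTinj : InjOn Prod.fst T := by
      rintro ⟨x, f⟩ hf ⟨x', g⟩ hg hxx
      obtain rfl : x = x' := hxx
      have hr : range f = range g := (hrange _ hf).trans (hrange _ hg).symm
      have hfm : StrictMono (e ∘ f) := fun i j hij => hf.2 i j hij
      have hgm : StrictMono (e ∘ g) := fun i j hij => hg.2 i j hij
      have hc : e ∘ f = e ∘ g := (hfm.range_inj hgm).1 (by rw [range_comp, range_comp, hr])
      have : f = g := hinj.comp_left hc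
      rw [this]
    have hA : MeasurableSet (Prod.fst '' T) := hT.image_of_measurable_injOn measurable_fst hTinj
    have hAeq : Prod.fst '' T = {x | {y | (x, y) ∈ R}.encard = (D + 1 : ℕ)} := by
      ext x
      constructor
      · rintro ⟨p, hp, rfl⟩
        have hpi : Function.Injective p.2 := by
          have : StrictMono (e ∘ p.2) := fun i j hij => hp.2 i j hij
          exact this.injective.of_comp
        change {y | (p.1, y) ∈ R}.encard = _
        rw [← hrange p hp, ← image_univ, hpi.encard_image, encard_univ]
        simp
      · intro hx
        change {y | (x, y) ∈ R}.encard = _ at hx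
        have hfin : {y | (x, y) ∈ R}.Finite := finite_of_encard_le_coe (hD x)
        let s : Finset ℝ := hfin.toFinset.map ⟨e, hinj⟩
        have hs : s.card = D + 1 := by
          rw [Finset.card_map]
          have := hfin.encard_eq_coe_toFinset_card
          rw [hx] at this
          exact_mod_cast this.symm
        have hmem : ∀ i, ∃ y, (x, y) ∈ R ∧ e y = s.orderEmbOfFin hs i := by
          intro i
          have hi := s.orderEmbOfFin_mem hs i
          obtain ⟨y, hy, hye⟩ := Finset.mem_map.1 hi
          exact ⟨y, hfin.mem_toFinset.1 hy, hye⟩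
        choose f hf1 hf2 using hmem
        refine ⟨(x, f), ⟨hf1, fun i j hij => ?_⟩, rfl⟩
        change e (f i) < e (f j)
        rw [hf2, hf2]
        exact (s.orderEmbOfFin hs).strictMono hij
    set A := Prod.fst '' T with hAdef
    let R' : Set (J × J) := R ∩ Prod.fst ⁻¹' Aᶜ
    have hR' : MeasurableSet R' := hR.inter (measurable_fst hA.compl)
    have key : ∀ x, x ∉ A → {y | (x, y) ∈ R'} = {y | (x, y) ∈ R} := by
      intro x hx
      ext y
      simp [R', hx]
    have key' : ∀ x, x ∈ A → {y | (x, y) ∈ R'} = ∅ := by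
      intro x hx
      ext y
      simp [R', hx]
    have hm := ih R' hR' (by
      intro x
      by_cases hx : x ∈ A
      · rw [key' x hx]
        simp
      · rw [key x hx]
        rw [hAeq] at hx
        have hlt : {y | (x, y) ∈ R}.encard < ((D + 1 : ℕ) : ℕ∞) := lt_of_le_of_ne (hD x) hx
        push_cast at hlt
        exact Order.le_of_lt_add_one hlt)
    classical
    have hfun : (fun x => {y | (x, y) ∈ R}.encard) =
        A.piecewise (fun _ => ((D + 1 : ℕ) : ℕ∞)) (fun x => {y | (x, y) ∈ R'}.encard) := by
      funext x
      by_cases hx : x ∈ A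
      · rw [piecewise_eq_of_mem _ _ _ hx]
        rw [hAeq] at hx
        exact hx
      · rw [piecewise_eq_of_notMem _ _ _ hx, key x hx]
    rw [hfun]
    exact Measurable.piecewise hA measurable_const hm

/-- A graphing on the standard Borel space `J`: a simple graph with vertex set `J` and Borel edge
set, all of whose degrees are at most some integer `D`, with a probability measure on `J`
satisfying the measure-preservation equation. The sigma-algebra on `Sym2 J` is the quotient one:
a set of unordered pairs is measurable iff the corresponding symmetric subset of `J × J` is. -/
structure Graphing (J : Type*) [MeasurableSpace J] where
  /-- the underlying graph `(J, E)`; its edge set is `E = graph.edgeSet` -/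
  graph : SimpleGraph J
  measurableSet_edgeSet : MeasurableSet graph.edgeSet
  exists_degree_le : ∃ D : ℕ, ∀ x, {y | graph.Adj x y}.encard ≤ D
  /-- the probability measure `λ` -/
  vol : Measure J
  isProbabilityMeasure : IsProbabilityMeasure vol
  measure_preserving : ∀ A B : Set J, MeasurableSet A → MeasurableSet B →
    ∫⁻ x in A, ({y | graph.Adj x y ∧ y ∈ B}.encard : ℝ≥0∞) ∂vol =
      ∫⁻ x in B, ({y | graph.Adj x y ∧ y ∈ A}.encard : ℝ≥0∞) ∂vol

namespace Graphing

theorem measurableSet_edgePairs {J : Type*} [MeasurableSpace J] {U : Set (Sym2 J)}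
    (hU : MeasurableSet U) : MeasurableSet {p : J × J | s(p.1, p.2) ∈ U} :=
  hU

variable {J : Type*} [MeasurableSpace J]

/-- `U` is a Borel subset of the edge set of the graphing. -/
def IsBorelEdgeSet (G : Graphing J) (U : Set (Sym2 J)) : Prop :=
  U ⊆ G.graph.edgeSet ∧ MeasurableSet U

/-- The average degree `∫ deg dλ`. -/
def avgDegree (G : Graphing J) : ℝ≥0∞ :=
  ∫⁻ x, ({y | G.graph.Adj x y}.encard : ℝ≥0∞) ∂G.vol

theorem measurable_encard (G : Graphing J) [StandardBorelSpace J] {S : Set (J × J)}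
    (hS : MeasurableSet S) :
    Measurable fun x => ({y | G.graph.Adj x y ∧ (x, y) ∈ S}.encard : ℝ≥0∞) := by
  obtain ⟨D, hD⟩ := G.exists_degree_le
  have hE : MeasurableSet {p : J × J | G.graph.Adj p.1 p.2} :=
    measurableSet_edgePairs G.measurableSet_edgeSet
  have h := measurable_encard_section D ({p : J × J | G.graph.Adj p.1 p.2} ∩ S) (hE.inter hS)
    (fun x => (encard_le_encard fun y hy => hy.1).trans (hD x))
  exact (measurable_of_countable (fun n : ℕ∞ => (n : ℝ≥0∞))).comp h

/-- The edge measure `η` on `J × J`: the measure of a Borel set `S` of ordered pairs is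
`(1 / d̄) ∫ #{y : xy ∈ E, (x, y) ∈ S} dλ(x)`. It is `0` if `d̄ = 0`. -/
def edgeMeasure (G : Graphing J) [StandardBorelSpace J] : Measure (J × J) :=
  Measure.ofMeasurable
    (fun S _ => G.avgDegree⁻¹ * ∫⁻ x, ({y | G.graph.Adj x y ∧ (x, y) ∈ S}.encard : ℝ≥0∞) ∂G.vol)
    (by simp)
    (by
      intro S hS hdisj
      rw [ENNReal.tsum_mul_left, ← lintegral_tsum fun i => (G.measurable_encard (hS i)).aemeasurable]
      congr 1
      refine lintegral_congr fun x => ?_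
      have hE : MeasurableSet {p : J × J | G.graph.Adj p.1 p.2} :=
        measurableSet_edgePairs G.measurableSet_edgeSet
      have hsec : ∀ i, MeasurableSet {y | G.graph.Adj x y ∧ (x, y) ∈ S i} := fun i =>
        measurable_prodMk_left (hE.inter (hS i))
      have hU : {y | G.graph.Adj x y ∧ (x, y) ∈ ⋃ i, S i} =
          ⋃ i, {y | G.graph.Adj x y ∧ (x, y) ∈ S i} := by
        ext y
        simp
      have hd : Pairwise (Function.onFun Disjoint
          fun i => {y | G.graph.Adj x y ∧ (x, y) ∈ S i}) := by
        intro i j hij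
        refine disjoint_left.2 fun y hy hy' => ?_
        exact disjoint_left.1 (hdisj hij) hy.2 hy'.2
      rw [hU, ← Measure.count_apply (MeasurableSet.iUnion hsec), measure_iUnion hd hsec]
      exact tsum_congr fun i => Measure.count_apply (hsec i))

/-- The edge measure extends the set function `A × B ↦ (1 / d̄) ∫_A deg_B dλ`. -/
theorem edgeMeasure_prod (G : Graphing J) [StandardBorelSpace J] {A B : Set J}
    (hA : MeasurableSet A) (hB : MeasurableSet B) :
    G.edgeMeasure (A ×ˢ B) =
      G.avgDegree⁻¹ * ∫⁻ x in A, ({y | G.graph.Adj x y ∧ y ∈ B}.encard : ℝ≥0∞) ∂G.vol := by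
  rw [edgeMeasure, Measure.ofMeasurable_apply _ (hA.prod hB), ← lintegral_indicator hA]
  congr 1
  refine lintegral_congr fun x => ?_
  by_cases hx : x ∈ A <;> simp [hx]

/-- `η(U)` for a set `U` of edges, read as the symmetric set of ordered pairs `(x, y)` with
`xy ∈ U`. -/
def eta (G : Graphing J) [StandardBorelSpace J] (U : Set (Sym2 J)) : ℝ :=
  G.edgeMeasure.real {p : J × J | s(p.1, p.2) ∈ U}

/-- `ρ(U) = 1 - E(1 / |U_x|)`, where `U_x` is the vertex set of the connected component of `(J, U)`
containing the `λ`-random point `x`, and `1 / |U_x| = 0` if `U_x` is infinite. -/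
def rho (G : Graphing J) (U : Set (Sym2 J)) : ℝ :=
  1 - (∫⁻ x, (((SimpleGraph.fromEdgeSet U).connectedComponentMk x).supp.encard : ℝ≥0∞)⁻¹
    ∂G.vol).toReal

/-- A graphing is hyperfinite if for every `ε > 0` there is a Borel set `X` of edges with
`η(X) < ε` whose removal leaves only finite connected components. -/
def IsHyperfinite (G : Graphing J) [StandardBorelSpace J] : Prop :=
  ∀ ε : ℝ, 0 < ε → ∃ X : Set (Sym2 J), G.IsBorelEdgeSet X ∧ G.eta X < ε ∧
    ∀ c : (G.graph.deleteEdges X).ConnectedComponent, c.supp.Finite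

end Graphing

end

/-!
Write `m` for the unnormalized edge measure on ordered pairs, `m = d̄ η`. The claim
`ρ(U) = d̄ η(U) / 2` reads `2 ∫ 1 / |U_x| dλ + m(U) = 2`.

Suppose first that all components of `(J, U)` are finite. Let each vertex `x` send along each edge
`xy` of `U` the fraction of its component that lies behind `y`, that is, the size of the component
of `y` after removal of `xy`, divided by `|U_x|`. Since the component is a tree, the parts behind the
neighbours of `x` partition `U_x \ {x}`, so `x` sends `1 - 1 / |U_x|` in total; and the parts behind
the two ends of an edge partition the component, so the masses sent along the edge in its two
directions add up to `1`. As `m` is invariant under swapping the ends of an edge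
(`Graphing.lintegral_pairMeasure_swap`), the total mass sent is `m(U) / 2`. This is
`Graphing.lintegral_inv_encard_add_pairMeasure`. Only transport along single edges is used; the
component sizes are measurable because degrees are bounded: the relation `edist x y ≤ n` is obtained
by projecting along neighbours, and Borel sets with sections of bounded size have Borel projections
and measurable section cardinalities.

For general `U`, hyperfiniteness and the Borel–Cantelli lemma give an increasing sequence of Borel
sets `V n ⊆ U` with finite components such that `U \ ⋃ n, V n` is null
(`Graphing.IsHyperfinite.exists_monotone`). Component sizes in `V n` increase to those in the union,
and a null set of edges is not met by the component of almost any vertex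
(`Graphing.ae_supp_eq_of_null`), so the identity passes to the limit.
-/

/-! ### Trees and forests -/

namespace SimpleGraph

variable {V : Type*} {H : SimpleGraph V}

theorem isAcyclic_of_forall_isTree_toSimpleGraph
    (h : ∀ c : H.ConnectedComponent, c.toSimpleGraph.IsTree) : H.IsAcyclic := by
  classical
  intro v p hp
  have hs : ∀ z ∈ p.support, z ∈ (H.connectedComponentMk v).supp := fun z hz =>
    (ConnectedComponent.sound (p.takeUntil z hz).reachable).symm
  have hac : (H.induce (H.connectedComponentMk v).supp).IsAcyclic :=
    (h (H.connectedComponentMk v)).isAcyclic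
  refine hac (p.induce _ hs) ?_
  have hmap := p.map_induce hs
  rw [← Walk.isCycle_map_iff_of_injective (f := (Embedding.induce _).toHom)
    Subtype.val_injective]
  rwa [hmap]

/-- The vertices that are strictly closer to `y` than to `x`. If `xy` is an edge of a forest, this
is the component of `y` after removal of `xy`. -/
def branch (H : SimpleGraph V) (x y : V) : Set V := {z | H.edist y z < H.edist x z}

theorem reachable_of_mem_branch {x y z : V} (hz : z ∈ H.branch x y) : H.Reachable y z :=
  reachable_of_edist_ne_top (ne_top_of_lt hz)

/-- A neighbour of `x` that is closer to `z` is the second vertex of a path from `x` to `z`. -/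
theorem Adj.exists_isPath_of_mem_branch {x y z : V} (hxy : H.Adj x y) (hz : z ∈ H.branch x y) :
    ∃ p : H.Walk x z, p.IsPath ∧ p.snd = y := by
  classical
  obtain ⟨q, hq⟩ := (reachable_of_mem_branch hz).exists_walk_length_eq_edist
  have hle : (q.bypass.length : ℕ∞) ≤ H.edist y z := by
    rw [← hq]
    exact_mod_cast q.length_bypass_le_length
  refine ⟨.cons hxy q.bypass, ?_, by simp⟩
  rw [Walk.cons_isPath_iff]
  refine ⟨q.bypass_isPath, fun hx => ?_⟩
  have h1 : H.edist x z ≤ (q.bypass.dropUntil x hx).length := Walk.edist_le _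
  have h2 : ((q.bypass.dropUntil x hx).length : ℕ∞) ≤ q.bypass.length := by
    exact_mod_cast Walk.length_dropUntil_le_length _ hx
  exact absurd (hz : H.edist y z < H.edist x z) (not_lt.2 ((h1.trans h2).trans hle))

theorem Reachable.exists_adj_mem_branch {x z : V} (h : H.Reachable x z) (hne : z ≠ x) :
    ∃ y, H.Adj x y ∧ z ∈ H.branch x y := by
  obtain ⟨p, hp⟩ := h.exists_walk_length_eq_edist
  cases p with
  | nil => exact absurd rfl hne
  | @cons _ y _ hxy q =>
    refine ⟨y, hxy, ?_⟩
    change H.edist y z < H.edist x z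
    rw [← hp]
    refine (Walk.edist_le q).trans_lt ?_
    rw [Walk.length_cons]
    exact_mod_cast Nat.lt_succ_self _

theorem IsAcyclic.disjoint_branch (hH : H.IsAcyclic) {x y y' : V} (hy : H.Adj x y)
    (hy' : H.Adj x y') (hne : y ≠ y') : Disjoint (H.branch x y) (H.branch x y') := by
  refine Set.disjoint_left.2 fun z hz hz' => hne ?_
  obtain ⟨p, hp, rfl⟩ := hy.exists_isPath_of_mem_branch hz
  obtain ⟨q, hq, rfl⟩ := hy'.exists_isPath_of_mem_branch hz'
  have := (hH.subsingleton_path x z).elim ⟨p, hp⟩ ⟨q, hq⟩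
  rw [Subtype.mk.injEq] at this
  rw [this]

/-- The vertices of a connected component of a forest other than `x` are partitioned by the branches
at `x`. -/
theorem IsAcyclic.encard_supp_eq_sum_branch (hH : H.IsAcyclic) {x : V}
    (hx : {y | H.Adj x y}.Finite) :
    (H.connectedComponentMk x).supp.encard =
      ∑ y ∈ hx.toFinset, (H.branch x y).encard + 1 := by
  have hU : (H.connectedComponentMk x).supp =
      insert x (⋃ y ∈ {y | H.Adj x y}, H.branch x y) := by
    ext z
    rw [ConnectedComponent.mem_supp_iff, ConnectedComponent.eq, mem_insert_iff]
    simp only [mem_iUnion, exists_prop]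
    constructor
    · intro h
      by_cases hz : z = x
      · exact Or.inl hz
      · exact Or.inr (h.symm.exists_adj_mem_branch hz)
    · rintro (rfl | ⟨y, hy, hz⟩)
      · exact Reachable.refl _
      · exact ((Adj.reachable hy).trans (reachable_of_mem_branch hz)).symm
  rw [hU, encard_insert_of_notMem, hx.encard_biUnion, finsum_mem_eq_finite_toFinset_sum _ hx]
  · intro y hy y' hy' hne
    exact hH.disjoint_branch hy hy' hne
  · simp [branch]

/-- The two branches at an edge of a forest partition the connected component of the edge. -/
theorem IsAcyclic.encard_branch_add_encard_branch (hH : H.IsAcyclic) {x y : V} (hxy : H.Adj x y) :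
    (H.branch x y).encard + (H.branch y x).encard = (H.connectedComponentMk x).supp.encard := by
  rw [← encard_union_eq]
  · congr 1
    ext z
    rw [ConnectedComponent.mem_supp_iff, ConnectedComponent.eq]
    constructor
    · rintro (h | h)
      · exact (hxy.reachable.trans (reachable_of_mem_branch h)).symm
      · exact (reachable_of_mem_branch h).symm
    · intro h
      have hx : H.Reachable x z := h.symm
      have hy : H.Reachable y z := hxy.symm.reachable.trans hx
      have hne : H.dist z x ≠ H.dist z y := hH.dist_ne_of_adj hxy h
      rcases lt_or_gt_of_ne hne with hlt | hlt
      · right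
        change H.edist x z < H.edist y z
        rw [← hx.coe_dist_eq_edist, ← hy.coe_dist_eq_edist, dist_comm, H.dist_comm (u := y)]
        exact_mod_cast hlt
      · left
        change H.edist y z < H.edist x z
        rw [← hx.coe_dist_eq_edist, ← hy.coe_dist_eq_edist, dist_comm, H.dist_comm (u := x)]
        exact_mod_cast hlt
  · refine Set.disjoint_left.2 fun z hz hz' => ?_
    exact lt_asymm (show H.edist y z < H.edist x z from hz) (show H.edist x z < H.edist y z from hz')

end SimpleGraph

/-! ### Measurability of section cardinalities -/

/-- The counting lemma for sections, with base and fibre in different spaces: the base is replaced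
by the product `α × β`, and the fibre over `(x, y)` by `{x} × R_x`. -/
theorem measurable_encard_section_prod {α β : Type*} [MeasurableSpace α] [StandardBorelSpace α]
    [MeasurableSpace β] [StandardBorelSpace β] {R : Set (α × β)} (hR : MeasurableSet R) (D : ℕ)
    (hD : ∀ x, {y | (x, y) ∈ R}.encard ≤ D) : Measurable fun x => {y | (x, y) ∈ R}.encard := by
  rcases isEmpty_or_nonempty β with hβ | ⟨⟨b⟩⟩
  · have : (fun x => {y | (x, y) ∈ R}.encard) = fun _ => 0 := by
      funext x
      rw [encard_eq_zero, eq_empty_iff_forall_notMem]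
      exact fun y => hβ.elim y
    rw [this]
    exact measurable_const
  let R' : Set ((α × β) × (α × β)) := {p | p.2.1 = p.1.1 ∧ (p.1.1, p.2.2) ∈ R}
  have hR' : MeasurableSet R' := by
    refine MeasurableSet.inter ?_ ?_
    · exact measurableSet_eq_fun (measurable_fst.comp measurable_snd)
        (measurable_fst.comp measurable_fst)
    · exact ((measurable_fst.comp measurable_fst).prodMk (measurable_snd.comp measurable_snd)) hR
  have heq : ∀ p : α × β, {q | (p, q) ∈ R'}.encard = {y | (p.1, y) ∈ R}.encard := by
    intro p
    have : {q | (p, q) ∈ R'} = Prod.mk p.1 '' {y | (p.1, y) ∈ R} := by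
      ext ⟨a, c⟩
      constructor
      · rintro ⟨h1, h2⟩
        exact ⟨c, h2, Prod.ext h1.symm rfl⟩
      · rintro ⟨y, hy, hyy⟩
        obtain ⟨rfl, rfl⟩ := Prod.mk.inj hyy
        exact ⟨rfl, hy⟩
    rw [this]
    exact (Prod.mk_right_injective p.1).encard_image _
  have h := measurable_encard_section D R' hR' fun p => (heq p).trans_le (hD p.1)
  simp_rw [heq] at h
  exact h.comp (measurable_id.prodMk (measurable_const (a := b)))

/-- Projections of Borel sets with sections of bounded size are Borel. -/
theorem measurableSet_exists_section {α β : Type*} [MeasurableSpace α] [StandardBorelSpace α]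
    [MeasurableSpace β] [StandardBorelSpace β] {R : Set (α × β)} (hR : MeasurableSet R) (D : ℕ)
    (hD : ∀ x, {y | (x, y) ∈ R}.encard ≤ D) : MeasurableSet {x | ∃ y, (x, y) ∈ R} := by
  have h := measurable_encard_section_prod hR D hD (measurableSet_singleton 0).compl
  convert h using 1
  ext x
  simp [nonempty_iff_ne_empty.symm, Set.Nonempty]

theorem Monotone.encard_iUnion {α : Type*} {s : ℕ → Set α} (hs : Monotone s) :
    ((⋃ n, s n).encard : ℝ≥0∞) = ⨆ n, ((s n).encard : ℝ≥0∞) := by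
  let _ : MeasurableSpace α := ⊤
  have h := hs.measure_iUnion (μ := Measure.count)
  simpa only [Measure.count_apply MeasurableSpace.measurableSet_top] using h

/-- Section cardinalities of an increasing union are suprema, so that boundedness is needed only for
each member of the sequence. -/
theorem measurable_encard_section_iUnion {α β : Type*} [MeasurableSpace α] [StandardBorelSpace α]
    [MeasurableSpace β] [StandardBorelSpace β] {R : ℕ → Set (α × β)} (hmono : Monotone R)
    (hR : ∀ n, MeasurableSet (R n)) (D : ℕ → ℕ) (hD : ∀ n x, {y | (x, y) ∈ R n}.encard ≤ D n) :
    Measurable fun x => ({y | (x, y) ∈ ⋃ n, R n}.encard : ℝ≥0∞) := by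
  have h : ∀ x, ({y | (x, y) ∈ ⋃ n, R n}.encard : ℝ≥0∞) =
      ⨆ n, ({y | (x, y) ∈ R n}.encard : ℝ≥0∞) := by
    intro x
    have hm : Monotone fun n => {y | (x, y) ∈ R n} := fun m n hmn y hy => hmono hmn hy
    rw [← Monotone.encard_iUnion hm]
    congr 2
    ext y
    simp
  simp_rw [h]
  exact Measurable.iSup fun n =>
    (measurable_of_countable fun n : ℕ∞ => (n : ℝ≥0∞)).comp
      (measurable_encard_section_prod (hR n) (D n) (hD n))

/-! ### Borel graphs of bounded degree -/

namespace SimpleGraph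

variable {J : Type*} {H : SimpleGraph J} {D : ℕ}

theorem setOf_exists_walk_length_succ (x : J) (n : ℕ) :
    {z | ∃ p : H.Walk x z, p.length = n + 1} =
      ⋃ y ∈ {y | H.Adj x y}, {z | ∃ p : H.Walk y z, p.length = n} := by
  ext z
  simp only [mem_iUnion, exists_prop]
  constructor
  · rintro ⟨p, hp⟩
    cases p with
    | nil => simp at hp
    | cons h q => exact ⟨_, h, q, by simpa using hp⟩
  · rintro ⟨y, hy, q, hq⟩
    exact ⟨.cons hy q, by simp [hq]⟩

theorem encard_setOf_exists_walk_le (hD : ∀ x, {y | H.Adj x y}.encard ≤ D) (n : ℕ) (x : J) :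
    {z | ∃ p : H.Walk x z, p.length = n}.encard ≤ (D ^ n : ℕ) := by
  induction n generalizing x with
  | zero =>
    rw [pow_zero, Nat.cast_one, encard_le_one_iff]
    rintro a b ⟨p, hp⟩ ⟨q, hq⟩
    rw [← p.eq_of_length_eq_zero hp, ← q.eq_of_length_eq_zero hq]
  | succ n ih =>
    have hfin : {y | H.Adj x y}.Finite := finite_of_encard_le_coe (hD x)
    rw [setOf_exists_walk_length_succ]
    refine (hfin.encard_biUnion_le _).trans ?_
    rw [finsum_mem_eq_finite_toFinset_sum _ hfin]
    refine (Finset.sum_le_card_nsmul _ _ _ fun y _ => ih y).trans ?_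
    have hc := hD x
    rw [hfin.encard_eq_coe_toFinset_card] at hc
    have hc' : hfin.toFinset.card ≤ D := by exact_mod_cast hc
    rw [nsmul_eq_mul, pow_succ']
    exact_mod_cast Nat.mul_le_mul_right _ hc'

theorem setOf_edist_le (x : J) (n : ℕ) :
    {z | H.edist x z ≤ n} =
      ⋃ m ∈ Finset.range (n + 1), {z | ∃ p : H.Walk x z, p.length = m} := by
  ext z
  simp only [mem_iUnion, exists_prop, Finset.mem_range]
  constructor
  · intro h
    obtain ⟨p, hp⟩ := exists_walk_of_edist_ne_top (ne_top_of_le_ne_top (ENat.natCast_ne_top n) h)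
    refine ⟨p.length, ?_, p, rfl⟩
    have : (p.length : ℕ∞) ≤ n := hp.trans_le h
    exact Nat.lt_succ_of_le (by exact_mod_cast this)
  · rintro ⟨m, hm, p, rfl⟩
    refine (Walk.edist_le p).trans ?_
    exact_mod_cast Nat.le_of_lt_succ hm

theorem encard_setOf_edist_le (hD : ∀ x, {y | H.Adj x y}.encard ≤ D) (n : ℕ) (x : J) :
    {z | H.edist x z ≤ n}.encard ≤ (∑ m ∈ Finset.range (n + 1), D ^ m : ℕ) := by
  rw [setOf_edist_le, Nat.cast_sum]
  exact ((Finset.range (n + 1)).set_encard_biUnion_le _).trans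
    (Finset.sum_le_sum fun m _ => encard_setOf_exists_walk_le hD m x)

variable [MeasurableSpace J] [StandardBorelSpace J]

/-- A walk of length `n + 1` from `x` is an edge to some neighbour of `x` followed by a walk of length
`n`, and projecting out the neighbour preserves Borel sets as degrees are bounded. -/
theorem measurableSet_exists_walk (hH : MeasurableSet {p : J × J | H.Adj p.1 p.2})
    (hD : ∀ x, {y | H.Adj x y}.encard ≤ D) (n : ℕ) :
    MeasurableSet {p : J × J | ∃ w : H.Walk p.1 p.2, w.length = n} := by
  induction n with
  | zero =>
    have : {p : J × J | ∃ w : H.Walk p.1 p.2, w.length = 0} = {p | p.1 = p.2} := by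
      ext p
      exact Walk.exists_length_eq_zero_iff
    rw [this]
    exact measurableSet_eq_fun measurable_fst measurable_snd
  | succ n ih =>
    let R : Set ((J × J) × J) :=
      {q | H.Adj q.1.1 q.2 ∧ ∃ w : H.Walk q.2 q.1.2, w.length = n}
    have hR : MeasurableSet R :=
      (((measurable_fst.comp measurable_fst).prodMk measurable_snd) hH).inter
        ((measurable_snd.prodMk (measurable_snd.comp measurable_fst)) ih)
    convert measurableSet_exists_section hR D fun p =>
      (encard_le_encard fun y hy => hy.1).trans (hD p.1) using 1
    ext ⟨x, z⟩
    have := Set.ext_iff.1 (setOf_exists_walk_length_succ (H := H) x n) z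
    simpa [R] using this

theorem measurableSet_edist_le (hH : MeasurableSet {p : J × J | H.Adj p.1 p.2})
    (hD : ∀ x, {y | H.Adj x y}.encard ≤ D) (n : ℕ) :
    MeasurableSet {p : J × J | H.edist p.1 p.2 ≤ n} := by
  have : {p : J × J | H.edist p.1 p.2 ≤ n} =
      ⋃ m ∈ Finset.range (n + 1), {p | ∃ w : H.Walk p.1 p.2, w.length = m} := by
    ext ⟨x, z⟩
    have := Set.ext_iff.1 (setOf_edist_le (H := H) x n) z
    simpa using this
  rw [this]
  exact Finset.measurableSet_biUnion _ fun m _ => measurableSet_exists_walk hH hD m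

theorem measurable_encard_supp (hH : MeasurableSet {p : J × J | H.Adj p.1 p.2})
    (hD : ∀ x, {y | H.Adj x y}.encard ≤ D) :
    Measurable fun x => ((H.connectedComponentMk x).supp.encard : ℝ≥0∞) := by
  convert measurable_encard_section_iUnion
    (R := fun n : ℕ => {p : J × J | H.edist p.1 p.2 ≤ n})
    (fun m n hmn p hp => le_trans (show H.edist p.1 p.2 ≤ m from hp) (by exact_mod_cast hmn))
    (measurableSet_edist_le hH hD) _ (encard_setOf_edist_le hD) using 4 with x
  ext z
  rw [ConnectedComponent.mem_supp_iff, ConnectedComponent.eq, reachable_comm,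
    ← edist_ne_top_iff_reachable, ENat.ne_top_iff_exists]
  simp only [mem_ofPred_eq, mem_iUnion]
  constructor
  · rintro ⟨n, hn⟩
    exact ⟨n, hn.ge⟩
  · rintro ⟨n, hn⟩
    exact ENat.ne_top_iff_exists.1 (ne_top_of_le_ne_top (ENat.natCast_ne_top n) hn)

theorem measurable_encard_branch (hH : MeasurableSet {p : J × J | H.Adj p.1 p.2})
    (hD : ∀ x, {y | H.Adj x y}.encard ≤ D) :
    Measurable fun p : J × J => ((H.branch p.1 p.2).encard : ℝ≥0∞) := by
  have hd := measurableSet_edist_le hH hD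
  have h1 : ∀ n : ℕ, MeasurableSet {q : (J × J) × J | H.edist q.1.1 q.2 ≤ n} := fun n =>
    ((measurable_fst.comp measurable_fst).prodMk measurable_snd) (hd n)
  have h2 : ∀ n : ℕ, MeasurableSet {q : (J × J) × J | H.edist q.1.2 q.2 ≤ n} := fun n =>
    ((measurable_snd.comp measurable_fst).prodMk measurable_snd) (hd n)
  have hlt : MeasurableSet {q : (J × J) × J | H.edist q.1.2 q.2 < H.edist q.1.1 q.2} := by
    have : {q : (J × J) × J | H.edist q.1.2 q.2 < H.edist q.1.1 q.2} =
        ⋃ n : ℕ, {q | H.edist q.1.2 q.2 ≤ n} \ {q | H.edist q.1.1 q.2 ≤ n} := by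
      ext q
      simp only [mem_iUnion, mem_sdiff, mem_ofPred_eq, not_le]
      constructor
      · intro h
        obtain ⟨n, hn⟩ := ENat.ne_top_iff_exists.1 (ne_top_of_lt h)
        exact ⟨n, hn.ge, hn.trans_lt h⟩
      · rintro ⟨n, hn, hn'⟩
        exact hn.trans_lt hn'
    rw [this]
    exact MeasurableSet.iUnion fun n => (h2 n).diff (h1 n)
  convert measurable_encard_section_iUnion
    (R := fun n : ℕ => {q : (J × J) × J | H.edist q.1.2 q.2 < H.edist q.1.1 q.2} ∩
      {q | H.edist q.1.2 q.2 ≤ n})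
    (fun m n hmn p hp => ⟨hp.1, le_trans (show H.edist p.1.2 p.2 ≤ m from hp.2)
      (by exact_mod_cast hmn)⟩)
    (fun n => hlt.inter (h2 n)) _
    (fun n p => (encard_le_encard fun z hz => hz.2).trans
      (encard_setOf_edist_le hD n p.2)) using 4 with p
  ext z
  rw [← inter_iUnion]
  refine ⟨fun h => ⟨h, ?_⟩, fun h => h.1⟩
  obtain ⟨n, hn⟩ := ENat.ne_top_iff_exists.1 (ne_top_of_lt (show H.edist p.2 z < _ from h))
  exact mem_iUnion.2 ⟨n, hn.ge⟩

end SimpleGraph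

/-! ### Mass transport along edges -/

namespace Graphing

open ProbabilityTheory

variable {J : Type*} [MeasurableSpace J]

instance (G : Graphing J) : IsProbabilityMeasure G.vol := G.isProbabilityMeasure

/-- The symmetric set of ordered pairs corresponding to a set of unordered pairs. -/
def edgePairs (U : Set (Sym2 J)) : Set (J × J) := {p | s(p.1, p.2) ∈ U}

theorem IsBorelEdgeSet.fromEdgeSet_adj {G : Graphing J} {U : Set (Sym2 J)}
    (hU : G.IsBorelEdgeSet U) {x y : J} :
    (SimpleGraph.fromEdgeSet U).Adj x y ↔ (x, y) ∈ edgePairs U := by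
  rw [SimpleGraph.fromEdgeSet_adj]
  exact ⟨fun h => h.1, fun h => ⟨h, (hU.1 h : G.graph.Adj x y).ne⟩⟩

theorem IsBorelEdgeSet.fromEdgeSet_le {G : Graphing J} {U : Set (Sym2 J)}
    (hU : G.IsBorelEdgeSet U) : SimpleGraph.fromEdgeSet U ≤ G.graph := fun x y h =>
  (hU.1 (hU.fromEdgeSet_adj.1 h) : G.graph.Adj x y)

theorem IsBorelEdgeSet.measurableSet_adj {G : Graphing J} {U : Set (Sym2 J)}
    (hU : G.IsBorelEdgeSet U) :
    MeasurableSet {p : J × J | (SimpleGraph.fromEdgeSet U).Adj p.1 p.2} := by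
  have : {p : J × J | (SimpleGraph.fromEdgeSet U).Adj p.1 p.2} = edgePairs U := by
    ext ⟨x, y⟩
    exact hU.fromEdgeSet_adj
  rw [this]
  exact measurableSet_edgePairs hU.2

theorem IsBorelEdgeSet.exists_degree_le {G : Graphing J} {U : Set (Sym2 J)}
    (hU : G.IsBorelEdgeSet U) :
    ∃ D : ℕ, ∀ x, {y | (SimpleGraph.fromEdgeSet U).Adj x y}.encard ≤ D := by
  obtain ⟨D, hD⟩ := G.exists_degree_le
  exact ⟨D, fun x => (encard_le_encard fun y hy => hU.fromEdgeSet_le hy).trans (hD x)⟩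

theorem measurableSet_neighbors (G : Graphing J) (x : J) : MeasurableSet {y | G.graph.Adj x y} :=
  measurable_prodMk_left (x := x) (measurableSet_edgePairs G.measurableSet_edgeSet)

theorem count_restrict_neighbors_apply (G : Graphing J) (x : J) {S : Set J}
    (hS : MeasurableSet S) :
    Measure.count.restrict {y | G.graph.Adj x y} S = {y | G.graph.Adj x y ∧ y ∈ S}.encard := by
  rw [Measure.restrict_apply hS, Measure.count_apply (hS.inter (G.measurableSet_neighbors x)),
    inter_comm]
  rfl

variable [StandardBorelSpace J]

/-- The kernel sending a vertex to the counting measure on its neighbours. -/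
noncomputable def neighborKernel (G : Graphing J) : Kernel J J where
  toFun x := Measure.count.restrict {y | G.graph.Adj x y}
  measurable' := by
    refine Measure.measurable_of_measurable_coe _ fun S hS => ?_
    simp_rw [G.count_restrict_neighbors_apply _ hS]
    exact G.measurable_encard (measurable_snd hS)

theorem neighborKernel_apply (G : Graphing J) (x : J) :
    G.neighborKernel x = Measure.count.restrict {y | G.graph.Adj x y} := rfl

instance (G : Graphing J) : IsFiniteKernel G.neighborKernel := by
  obtain ⟨D, hD⟩ := G.exists_degree_le
  refine ⟨D, ENNReal.natCast_lt_top D, fun x => ?_⟩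
  rw [neighborKernel_apply, G.count_restrict_neighbors_apply x MeasurableSet.univ]
  simpa using ENat.toENNReal_le.2 (hD x)

/-- The unnormalized edge measure: the distribution of mass over ordered pairs `(x, y)` of adjacent
vertices, where `x` is weighted by `λ` and its neighbours `y` are counted. -/
noncomputable def pairMeasure (G : Graphing J) : Measure (J × J) := G.vol ⊗ₘ G.neighborKernel

instance (G : Graphing J) : IsFiniteMeasure G.pairMeasure := by
  unfold pairMeasure
  infer_instance

theorem pairMeasure_apply (G : Graphing J) {S : Set (J × J)} (hS : MeasurableSet S) :
    G.pairMeasure S = ∫⁻ x, ({y | G.graph.Adj x y ∧ (x, y) ∈ S}.encard : ℝ≥0∞) ∂G.vol := by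
  rw [pairMeasure, Measure.compProd_apply hS]
  refine lintegral_congr fun x => ?_
  rw [neighborKernel_apply, G.count_restrict_neighbors_apply x (measurable_prodMk_left hS)]
  rfl

theorem pairMeasure_univ (G : Graphing J) : G.pairMeasure univ = G.avgDegree := by
  rw [G.pairMeasure_apply MeasurableSet.univ, avgDegree]
  simp

theorem avgDegree_ne_top (G : Graphing J) : G.avgDegree ≠ ⊤ := by
  rw [← G.pairMeasure_univ]
  exact measure_ne_top _ _

theorem edgeMeasure_eq_smul (G : Graphing J) :
    G.edgeMeasure = G.avgDegree⁻¹ • G.pairMeasure := by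
  ext S hS
  rw [edgeMeasure, Measure.ofMeasurable_apply _ hS, Measure.smul_apply, G.pairMeasure_apply hS,
    smul_eq_mul]

theorem pairMeasure_eq_smul (G : Graphing J) :
    G.pairMeasure = G.avgDegree • G.edgeMeasure := by
  -- If `d̄ = 0`, then both sides vanish, since `d̄` is the total mass of the left-hand side.
  rcases eq_or_ne G.avgDegree 0 with h | h
  · rw [h, zero_smul, ← Measure.measure_univ_eq_zero, pairMeasure_univ, h]
  · rw [edgeMeasure_eq_smul, smul_smul, ENNReal.mul_inv_cancel h G.avgDegree_ne_top, one_smul]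

instance (G : Graphing J) : IsFiniteMeasure G.edgeMeasure := by
  refine ⟨?_⟩
  rw [edgeMeasure_eq_smul, Measure.smul_apply, pairMeasure_univ, smul_eq_mul]
  exact (ENNReal.inv_mul_le_one _).trans_lt ENNReal.one_lt_top

theorem avgDegree_mul_eta (G : Graphing J) (U : Set (Sym2 J)) :
    G.avgDegree.toReal * G.eta U = G.pairMeasure.real (edgePairs U) := by
  rw [pairMeasure_eq_smul, measureReal_ennreal_smul_apply]
  rfl

theorem map_swap_pairMeasure (G : Graphing J) : G.pairMeasure.map Prod.swap = G.pairMeasure := by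
  symm
  refine Measure.ext_prod fun {A B} hA hB => ?_
  have h : ∀ {A B : Set J}, MeasurableSet A → MeasurableSet B → G.pairMeasure (A ×ˢ B) =
      ∫⁻ x in A, ({y | G.graph.Adj x y ∧ y ∈ B}.encard : ℝ≥0∞) ∂G.vol := by
    intro A B hA hB
    rw [pairMeasure, Measure.compProd_apply_prod hA hB]
    exact lintegral_congr fun x => G.count_restrict_neighbors_apply x hB
  rw [Measure.map_apply measurable_swap (hA.prod hB), preimage_swap_prod, h hA hB, h hB hA,
    G.measure_preserving A B hA hB]

/-- Mass transport: mass sent along edges and mass received along edges have the same total. -/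
theorem lintegral_pairMeasure_swap (G : Graphing J) {f : J × J → ℝ≥0∞} (hf : Measurable f) :
    ∫⁻ p, f p.swap ∂G.pairMeasure = ∫⁻ p, f p ∂G.pairMeasure := by
  conv_rhs => rw [← G.map_swap_pairMeasure, lintegral_map hf measurable_swap]

/-! ### Borel edge sets with finite components -/

/-- In the forest `(J, U)` with finite components, let every vertex `x` send along each edge `xy`
the fraction of its component that lies behind `y`. A vertex sends `1 - 1 / |U_x|` in total, and the
two masses sent along an edge add up to `1`. -/
theorem lintegral_inv_encard_add_pairMeasure (G : Graphing J) (hG : G.graph.IsAcyclic)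
    {U : Set (Sym2 J)} (hU : G.IsBorelEdgeSet U)
    (hfin : ∀ x, ((SimpleGraph.fromEdgeSet U).connectedComponentMk x).supp.Finite) :
    2 * ∫⁻ x, (((SimpleGraph.fromEdgeSet U).connectedComponentMk x).supp.encard : ℝ≥0∞)⁻¹ ∂G.vol +
      G.pairMeasure (edgePairs U) = 2 := by
  set H := SimpleGraph.fromEdgeSet U
  have hH : H.IsAcyclic := hG.anti hU.fromEdgeSet_le
  obtain ⟨D, hD⟩ := hU.exists_degree_le
  have hUm : MeasurableSet (edgePairs U) := measurableSet_edgePairs hU.2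
  let n : J → ℝ≥0∞ := fun x => (H.connectedComponentMk x).supp.encard
  have hn : Measurable n := SimpleGraph.measurable_encard_supp hU.measurableSet_adj hD
  have hn0 : ∀ x, n x ≠ 0 := fun x => by
    have : (H.connectedComponentMk x).supp.Nonempty := ⟨x, rfl⟩
    simpa [n] using this.ne_empty
  have hnt : ∀ x, n x ≠ ⊤ := fun x => by
    simpa [n] using hfin x
  let g : J × J → ℝ≥0∞ := fun p => (H.branch p.1 p.2).encard * (n p.1)⁻¹
  have hg : Measurable g :=
    (SimpleGraph.measurable_encard_branch hU.measurableSet_adj hD).mul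
      (hn.comp measurable_fst).inv
  let F : J × J → ℝ≥0∞ := (edgePairs U).indicator g
  have hF : Measurable F := hg.indicator hUm
  -- The two branches at an edge partition its component, so the two masses add up to `1`.
  have hedge : ∀ p, F p + F p.swap = (edgePairs U).indicator 1 p := by
    rintro ⟨x, y⟩
    by_cases hp : (x, y) ∈ edgePairs U
    · have hp' : (x, y).swap ∈ edgePairs U := by
        change s(y, x) ∈ U
        rw [Sym2.eq_swap]
        exact hp
      have hadj : H.Adj x y := hU.fromEdgeSet_adj.2 hp
      have hnxy : n y = n x := by
        simp only [n, SimpleGraph.ConnectedComponent.sound hadj.reachable]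
      simp only [F, indicator_of_mem hp, indicator_of_mem hp']
      change _ * (n x)⁻¹ + _ * (n y)⁻¹ = 1
      rw [hnxy, ← add_mul, ← ENat.toENNReal_add]
      change (((H.branch x y).encard + (H.branch y x).encard : ℕ∞) : ℝ≥0∞) * _ = 1
      rw [hH.encard_branch_add_encard_branch hadj]
      exact ENNReal.mul_inv_cancel (hn0 x) (hnt x)
    · have hp' : (x, y).swap ∉ edgePairs U := by
        change ¬ s(y, x) ∈ U
        rw [Sym2.eq_swap]
        exact hp
      simp only [F, indicator_of_notMem hp, indicator_of_notMem hp', add_zero]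
  -- The branches at `x` partition the component of `x` without `x` itself.
  have hvert : ∀ x, ∫⁻ y, F (x, y) ∂G.neighborKernel x + (n x)⁻¹ = 1 := by
    intro x
    have hNf : {y | H.Adj x y}.Finite := finite_of_encard_le_coe (hD x)
    have h1 : ∫⁻ y, F (x, y) ∂G.neighborKernel x =
        ∑ y ∈ hNf.toFinset, ((H.branch x y).encard : ℝ≥0∞) * (n x)⁻¹ := by
      have h2 : (fun y => F (x, y)) = {y | H.Adj x y}.indicator fun y => g (x, y) := by
        funext y
        by_cases hp : (x, y) ∈ edgePairs U
        · have hp' : y ∈ {y | H.Adj x y} := hU.fromEdgeSet_adj.2 hp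
          rw [indicator_of_mem hp']
          exact indicator_of_mem hp _
        · have hp' : y ∉ {y | H.Adj x y} := fun h => hp (hU.fromEdgeSet_adj.1 h)
          rw [indicator_of_notMem hp']
          exact indicator_of_notMem hp _
      have hsub : {y | H.Adj x y} ⊆ {y | G.graph.Adj x y} := fun y hy => hU.fromEdgeSet_le hy
      rw [h2, lintegral_indicator hNf.measurableSet, neighborKernel_apply,
        Measure.restrict_restrict hNf.measurableSet,
        inter_eq_self_of_subset_left hsub]
      conv_lhs => rw [← hNf.coe_toFinset, lintegral_finset]
      simp [g]
    have h3 := congrArg (fun k : ℕ∞ => (k : ℝ≥0∞)) (hH.encard_supp_eq_sum_branch hNf)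
    have h4 : n x = ∑ y ∈ hNf.toFinset, ((H.branch x y).encard : ℝ≥0∞) + 1 := by
      have h5 := map_sum ENat.toENNRealRingHom (fun y => (H.branch x y).encard) hNf.toFinset
      refine h3.trans ?_
      rw [ENat.toENNReal_add, ENat.toENNReal_one]
      exact congrArg (· + 1) h5
    rw [h1, ← Finset.sum_mul]
    nth_rw 2 [← one_mul (n x)⁻¹]
    rw [← add_mul, ← h4]
    exact ENNReal.mul_inv_cancel (hn0 x) (hnt x)
  have hsum1 : ∫⁻ p, F p ∂G.pairMeasure + ∫⁻ x, (n x)⁻¹ ∂G.vol = 1 := by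
    rw [pairMeasure, Measure.lintegral_compProd hF,
      ← lintegral_add_right _ (show Measurable fun x => (n x)⁻¹ from hn.inv)]
    simp_rw [hvert]
    simp
  have hsum2 : ∫⁻ p, F p ∂G.pairMeasure + ∫⁻ p, F p ∂G.pairMeasure =
      G.pairMeasure (edgePairs U) := by
    nth_rw 2 [← G.lintegral_pairMeasure_swap hF]
    rw [← lintegral_add_left hF]
    simp_rw [hedge]
    exact lintegral_indicator_one hUm
  rw [← hsum2, ← two_mul, ← mul_add, add_comm, hsum1, mul_one]

end Graphing

/-! ### Approximation by edge sets with finite components -/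

namespace SimpleGraph

variable {V : Type*}

/-- Components of an increasing union of graphs are increasing unions of components. -/
theorem supp_connectedComponentMk_iUnion {H : ℕ → SimpleGraph V} (hH : Monotone H)
    {K : SimpleGraph V} (hK : ∀ x y, K.Adj x y ↔ ∃ n, (H n).Adj x y) (x : V) :
    (K.connectedComponentMk x).supp = ⋃ n, ((H n).connectedComponentMk x).supp := by
  ext z
  simp only [mem_iUnion, ConnectedComponent.mem_supp_iff, ConnectedComponent.eq]
  constructor
  · rintro ⟨p⟩
    induction p with
    | nil => exact ⟨0, Reachable.refl _⟩
    | cons h q ih =>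
      obtain ⟨n, hn⟩ := ih
      obtain ⟨m, hm⟩ := (hK _ _).1 h
      exact ⟨max m n, (Adj.reachable (hH (le_max_left m n) hm)).trans
        (hn.mono (hH (le_max_right m n)))⟩
  · rintro ⟨n, hn⟩
    exact hn.mono fun a b hab => (hK a b).2 ⟨n, hab⟩

end SimpleGraph

namespace Graphing

open Filter Topology

variable {J : Type*} [MeasurableSpace J] [StandardBorelSpace J]

/-- A property of almost all vertices holds for all neighbours of almost all vertices. -/
theorem ae_forall_adj (G : Graphing J) {q : J → Prop} (hq : ∀ᵐ x ∂G.vol, q x) :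
    ∀ᵐ x ∂G.vol, ∀ y, G.graph.Adj x y → q y := by
  obtain ⟨A, hqA, hA, hA0⟩ := exists_measurable_superset_of_null (ae_iff.1 hq)
  have h := G.measure_preserving univ A MeasurableSet.univ hA
  rw [Measure.restrict_univ, setLIntegral_measure_zero _ _ hA0,
    lintegral_eq_zero_iff (by simpa using G.measurable_encard (measurable_snd hA))] at h
  filter_upwards [h] with x hx y hxy
  by_contra hy
  have hempty : {y | G.graph.Adj x y ∧ y ∈ A} = ∅ := by simpa using hx
  exact eq_empty_iff_forall_notMem.1 hempty y ⟨hxy, hqA hy⟩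

theorem ae_forall_reachable (G : Graphing J) {q : J → Prop} (hq : ∀ᵐ x ∂G.vol, q x) :
    ∀ᵐ x ∂G.vol, ∀ y, G.graph.Reachable x y → q y := by
  have h : ∀ n : ℕ, ∀ᵐ x ∂G.vol, ∀ y, ∀ p : G.graph.Walk x y, p.length = n → q y := by
    intro n
    induction n with
    | zero =>
      filter_upwards [hq] with x hx y p hp
      rwa [← p.eq_of_length_eq_zero hp]
    | succ n ih =>
      filter_upwards [G.ae_forall_adj ih] with x hx y p hp
      cases p with
      | nil => simp at hp
      | cons h p => exact hx _ h y p (by simpa using hp)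
  filter_upwards [ae_all_iff.2 h] with x hx y hxy
  obtain ⟨p⟩ := hxy
  exact hx p.length y p rfl

/-- Removing a null set of edges does not change the component of almost any vertex. -/
theorem ae_supp_eq_of_null (G : Graphing J) {U V : Set (Sym2 J)} (hU : G.IsBorelEdgeSet U)
    (hV : G.IsBorelEdgeSet V) (hVU : V ⊆ U) (h0 : G.pairMeasure (edgePairs (U \ V)) = 0) :
    ∀ᵐ x ∂G.vol, ((SimpleGraph.fromEdgeSet U).connectedComponentMk x).supp =
      ((SimpleGraph.fromEdgeSet V).connectedComponentMk x).supp := by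
  have hm : MeasurableSet (edgePairs (U \ V)) := measurableSet_edgePairs (hU.2.diff hV.2)
  rw [G.pairMeasure_apply hm, lintegral_eq_zero_iff (G.measurable_encard hm)] at h0
  have h1 : ∀ᵐ x ∂G.vol, ∀ y, (SimpleGraph.fromEdgeSet U).Adj x y →
      (SimpleGraph.fromEdgeSet V).Adj x y := by
    filter_upwards [h0] with x hx y hxy
    have hempty : {y | G.graph.Adj x y ∧ (x, y) ∈ edgePairs (U \ V)} = ∅ := by simpa using hx
    by_contra hV'
    exact eq_empty_iff_forall_notMem.1 hempty y ⟨hU.fromEdgeSet_le hxy,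
      hU.fromEdgeSet_adj.1 hxy, fun h => hV' (hV.fromEdgeSet_adj.2 h)⟩
  filter_upwards [G.ae_forall_reachable h1] with x hx
  ext z
  simp only [SimpleGraph.ConnectedComponent.mem_supp_iff, SimpleGraph.ConnectedComponent.eq]
  rw [SimpleGraph.reachable_comm, SimpleGraph.reachable_comm (v := x)]
  refine ⟨?_, fun h => h.mono (SimpleGraph.fromEdgeSet_mono hVU)⟩
  rintro ⟨p⟩
  induction p with
  | nil => exact SimpleGraph.Reachable.refl _
  | cons h p ih =>
    refine (SimpleGraph.Adj.reachable (hx _ (SimpleGraph.Reachable.refl _) _ h)).trans (ih ?_)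
    exact fun y hy => hx y ((SimpleGraph.Adj.reachable (hU.fromEdgeSet_le h)).trans hy)

/-- In a hyperfinite graphing, every Borel edge set is, up to a null set, an increasing union of
Borel edge sets with finite components. -/
theorem IsHyperfinite.exists_monotone (G : Graphing J) (hG : G.IsHyperfinite) {U : Set (Sym2 J)}
    (hU : G.IsBorelEdgeSet U) :
    ∃ V : ℕ → Set (Sym2 J), Monotone V ∧ (∀ n, G.IsBorelEdgeSet (V n)) ∧
      (∀ n x, ((SimpleGraph.fromEdgeSet (V n)).connectedComponentMk x).supp.Finite) ∧
      (⋃ n, V n) ⊆ U ∧ G.pairMeasure (edgePairs (U \ ⋃ n, V n)) = 0 := by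
  -- Summability of the `η (X n)` makes the edges lying in infinitely many `X n` a null set.
  choose X hX hXeta hXfin using fun n : ℕ => hG ((1 / 2 : ℝ) ^ n) (by positivity)
  have hsum : ∑' n, G.edgeMeasure (edgePairs (X n)) ≠ ⊤ := by
    have hle : ∀ n, G.edgeMeasure (edgePairs (X n)) ≤ ENNReal.ofReal ((1 / 2 : ℝ) ^ n) := by
      intro n
      rw [← ofReal_measureReal]
      exact ENNReal.ofReal_le_ofReal (hXeta n).le
    refine ne_top_of_le_ne_top ?_ (ENNReal.tsum_le_tsum hle)
    rw [← ENNReal.ofReal_tsum_of_nonneg (fun n => by positivity) summable_geometric_two]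
    exact ENNReal.ofReal_ne_top
  refine ⟨fun n => U \ ⋃ k ≥ n, X k, ?_, ?_, ?_, ?_, ?_⟩
  · intro m n hmn e he
    refine ⟨he.1, fun h => he.2 ?_⟩
    simp only [mem_iUnion, exists_prop] at h ⊢
    obtain ⟨k, hk, hek⟩ := h
    exact ⟨k, hmn.trans hk, hek⟩
  · intro n
    exact ⟨sdiff_subset.trans hU.1, hU.2.diff <| MeasurableSet.iUnion fun k =>
      MeasurableSet.iUnion fun _ => (hX k).2⟩
  · intro n x
    refine (hXfin n ((G.graph.deleteEdges (X n)).connectedComponentMk x)).subset ?_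
    intro z hz
    rw [SimpleGraph.ConnectedComponent.mem_supp_iff, SimpleGraph.ConnectedComponent.eq] at hz ⊢
    refine hz.mono fun a b hab => ?_
    rw [SimpleGraph.fromEdgeSet_adj] at hab
    rw [SimpleGraph.deleteEdges_adj]
    refine ⟨hU.1 hab.1.1, fun h => hab.1.2 ?_⟩
    simp only [mem_iUnion, exists_prop]
    exact ⟨n, le_rfl, h⟩
  · exact iUnion_subset fun n => sdiff_subset
  · rw [pairMeasure_eq_smul, Measure.smul_apply]
    have h0 : G.edgeMeasure (limsup (fun n => edgePairs (X n)) atTop) = 0 :=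
      measure_limsup_atTop_eq_zero hsum
    rw [measure_mono_null ?_ h0, smul_zero]
    rintro ⟨x, y⟩ ⟨h1, h2⟩
    rw [limsup_eq_iInf_iSup_of_nat]
    simp only [iInf_eq_iInter, iSup_eq_iUnion, mem_iInter, mem_iUnion, exists_prop]
    intro n
    by_contra hn
    refine h2 (mem_iUnion.2 ⟨n, h1, fun h => hn ?_⟩)
    obtain ⟨k, hk, hek⟩ := by simpa only [mem_iUnion, exists_prop] using h
    exact ⟨k, hk, hek⟩

/-- Both terms pass to the limit along an exhaustion by edge sets with finite components: component
sizes increase to the component sizes of the union, and its complement in `U` is null. -/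
theorem lintegral_inv_encard_add_pairMeasure_of_isHyperfinite (G : Graphing J)
    (hyp : G.IsHyperfinite) (hG : G.graph.IsAcyclic) {U : Set (Sym2 J)}
    (hU : G.IsBorelEdgeSet U) :
    2 * ∫⁻ x, (((SimpleGraph.fromEdgeSet U).connectedComponentMk x).supp.encard : ℝ≥0∞)⁻¹ ∂G.vol +
      G.pairMeasure (edgePairs U) = 2 := by
  obtain ⟨V, hmono, hV, hfin, hVU, h0⟩ := hyp.exists_monotone G hU
  set W := ⋃ n, V n with hWdef
  have hW : G.IsBorelEdgeSet W := ⟨hVU.trans hU.1, MeasurableSet.iUnion fun n => (hV n).2⟩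
  let I : Set (Sym2 J) → J → ℝ≥0∞ := fun S x =>
    (((SimpleGraph.fromEdgeSet S).connectedComponentMk x).supp.encard : ℝ≥0∞)⁻¹
  have hIm : ∀ n, Measurable (I (V n)) := fun n => by
    obtain ⟨D, hD⟩ := (hV n).exists_degree_le
    exact (SimpleGraph.measurable_encard_supp (hV n).measurableSet_adj hD).inv
  have hsm : ∀ x, Monotone fun n =>
      ((SimpleGraph.fromEdgeSet (V n)).connectedComponentMk x).supp := by
    intro x m n hmn z hz
    rw [SimpleGraph.ConnectedComponent.mem_supp_iff, SimpleGraph.ConnectedComponent.eq] at hz ⊢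
    exact hz.mono (SimpleGraph.fromEdgeSet_mono (hmono hmn))
  have hanti : Antitone fun n => I (V n) := fun m n hmn x =>
    ENNReal.inv_le_inv.2 (ENat.toENNReal_le.2 (encard_le_encard (hsm x hmn)))
  have hI1 : ∀ S x, I S x ≤ 1 := by
    intro S x
    have h : (1 : ℕ∞) ≤ ((SimpleGraph.fromEdgeSet S).connectedComponentMk x).supp.encard :=
      one_le_encard_iff_nonempty.2 ⟨x, rfl⟩
    exact ENNReal.inv_le_one.2 (by exact_mod_cast h)
  have hIW : ∀ x, I W x = ⨅ n, I (V n) x := by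
    intro x
    have hK : ∀ a b, (SimpleGraph.fromEdgeSet W).Adj a b ↔
        ∃ n, (SimpleGraph.fromEdgeSet (V n)).Adj a b := by
      intro a b
      simp [hWdef]
    simp only [I]
    rw [SimpleGraph.supp_connectedComponentMk_iUnion
      (fun m n hmn => SimpleGraph.fromEdgeSet_mono (hmono hmn)) hK,
      Monotone.encard_iUnion (hsm x), ENNReal.inv_iSup]
  have hlimI : Tendsto (fun n => ∫⁻ x, I (V n) x ∂G.vol) atTop (𝓝 (∫⁻ x, I W x ∂G.vol)) := by
    simp_rw [hIW]
    rw [lintegral_iInf hIm hanti]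
    · exact tendsto_atTop_iInf fun m n hmn => lintegral_mono (hanti hmn)
    · refine ne_top_of_le_ne_top ENNReal.one_ne_top ((lintegral_mono (hI1 _)).trans ?_)
      simp
  have hlimM : Tendsto (fun n => G.pairMeasure (edgePairs (V n))) atTop
      (𝓝 (G.pairMeasure (edgePairs W))) := by
    have hunion : edgePairs W = ⋃ n, edgePairs (V n) := by
      ext p
      simp [edgePairs, hWdef]
    rw [hunion]
    exact tendsto_measure_iUnion_atTop fun m n hmn p hp => hmono hmn hp
  have hlim := (ENNReal.Tendsto.const_mul (a := (2 : ℝ≥0∞)) hlimI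
    (Or.inr ENNReal.ofNat_ne_top)).add hlimM
  have heq : ∀ n, 2 * ∫⁻ x, I (V n) x ∂G.vol + G.pairMeasure (edgePairs (V n)) = 2 := fun n =>
    G.lintegral_inv_encard_add_pairMeasure hG (hV n) (hfin n)
  simp_rw [heq] at hlim
  have hWeq := tendsto_nhds_unique hlim tendsto_const_nhds
  have hIU : ∫⁻ x, I U x ∂G.vol = ∫⁻ x, I W x ∂G.vol := by
    refine lintegral_congr_ae ?_
    filter_upwards [G.ae_supp_eq_of_null hU hW hVU h0] with x hx
    simp only [I, hx]
  have hMU : G.pairMeasure (edgePairs U) = G.pairMeasure (edgePairs W) := by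
    refine le_antisymm ?_ (measure_mono fun p hp => hVU hp)
    have hsub : edgePairs U ⊆ edgePairs W ∪ edgePairs (U \ W) := fun p hp => by
      by_cases h : p ∈ edgePairs W
      · exact Or.inl h
      · exact Or.inr ⟨hp, h⟩
    refine (measure_mono hsub).trans ((measure_union_le _ _).trans ?_)
    rw [h0, add_zero]
  change 2 * ∫⁻ x, I U x ∂G.vol + _ = 2
  rw [hIU, hMU, hWeq]

end Graphing

theorem mainTheorem4 {J : Type*} [MeasurableSpace J] [StandardBorelSpace J] (G : Graphing J)
    (hyperfinite : G.IsHyperfinite)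
    (forest : ∀ c : G.graph.ConnectedComponent, c.toSimpleGraph.IsTree) :
    (∀ U : Set (Sym2 J), G.IsBorelEdgeSet U →
      G.rho U = G.avgDegree.toReal / 2 * G.eta U) ∧
    ∃ μ : Measure (Sym2 J), IsFiniteMeasure μ ∧
      ∀ U : Set (Sym2 J), G.IsBorelEdgeSet U → μ.real U = G.rho U := by
  have hG := SimpleGraph.isAcyclic_of_forall_isTree_toSimpleGraph forest
  have key : ∀ U : Set (Sym2 J), G.IsBorelEdgeSet U →
      G.rho U = G.avgDegree.toReal / 2 * G.eta U := by
    intro U hU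
    have h := G.lintegral_inv_encard_add_pairMeasure_of_isHyperfinite hyperfinite hG hU
    have hne : ∫⁻ x, (((SimpleGraph.fromEdgeSet U).connectedComponentMk x).supp.encard : ℝ≥0∞)⁻¹
        ∂G.vol ≠ ⊤ := by
      intro htop
      rw [htop, ENNReal.mul_top two_ne_zero, top_add] at h
      exact ENNReal.ofNat_ne_top h.symm
    have hreal := congrArg ENNReal.toReal h
    rw [ENNReal.toReal_add (ENNReal.mul_ne_top ENNReal.ofNat_ne_top hne) (measure_ne_top _ _),
      ENNReal.toReal_mul, ENNReal.toReal_ofNat, ← measureReal_def, ← G.avgDegree_mul_eta] at hreal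
    rw [Graphing.rho]
    linarith
  refine ⟨key, (G.avgDegree / 2) • G.edgeMeasure.map fun p => s(p.1, p.2), ?_, ?_⟩
  · exact Measure.smul_finite _ (ENNReal.div_ne_top G.avgDegree_ne_top two_ne_zero)
  · intro U hU
    have hmeas : Measurable fun p : J × J => s(p.1, p.2) := fun S hS => hS
    rw [key U hU, measureReal_ennreal_smul_apply, map_measureReal_apply hmeas hU.2,
      ENNReal.toReal_div, ENNReal.toReal_ofNat]
    rfl
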